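/- Let $X$ be a nonempty compact metric space with Borel $\sigma$-algebra $\mathcal B$, let $m$ be a finite measure on $(X,\mathcal B)$ (the reference measure, not assumed invariant), and let $Q(x,A)$, $x\in X$, $A\in\mathcal B$, be the one-step transition probabilities (a Markov kernel) of a homogeneous discrete-time Markov chain on $X$. Let $Q^t(x,A)$ be the $t$-step transition probabilities and put $Q^{-t}(A):=\{x\in X: Q^t(x,A)>0\}$. A point $x\in X$ is called recurrent if for every open $O\ni x$ there is an integer $t\ge1$ with $Q^t(x,O)>0$; weakly recurrent if for every open $O\ni x$ there are $y\in O$ and an integer $t\ge1$ with $Q^t(y,O)>0$; uniformly recurrent if $\liminf_{n\to\infty}Q^n(x,O)>0$ for every open $O\ni x$; weakly uniformly recurrent if for every open $O\ni x$ there is $y\in O$ with $\liminf_{n\to\infty}Q^n(y,O)>0$. Denote the sets of these points by $\mathrm{Rec}(Q)$, $\mathrm{Rec}_w(Q)$, $\mathrm{Rec}_u(Q)$, $\mathrm{Rec}_{wu}(Q)$ respectively. Then: (0) $\mathrm{Rec}(Q)\supseteq\mathrm{Rec}_u(Q)\subseteq\mathrm{Rec}_{wu}(Q)\subseteq\mathrm{Rec}_w(Q)\supseteq\mathrm{Clos}(\mathrm{Rec}(Q))$.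 (a) If $\sum_{n\ge1}m(Q^{-n}(A)\cap A)=\infty$ for every $A\in\mathcal B$ with $m(A)>0$, then $m(\mathrm{Rec}(Q))=m(X)$ (so $m(\mathrm{Rec}(Q))=1$ when $m$ is a probability measure) and $\mathrm{supp}(m)\subseteq\mathrm{Rec}_w(Q)$. (b) $\mathrm{Rec}_w(Q)\neq\emptyset$. (c) If $\mu$ is a probability measure on $(X,\mathcal B)$ that is invariant for the chain, i.e. $\int Q(x,A)\,d\mu(x)=\mu(A)$ for all $A\in\mathcal B$, then $\mu(\mathrm{Rec}(Q))=1$. -/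

import Mathlib

open MeasureTheory ProbabilityTheory

namespace MarkovRecurrence

variable {X : Type*} [MeasurableSpace X]

/-- The `t`-preimage `Q^{-t}(B)`: the points from which the chain is in `B` at time `t` with
positive probability. Here `Q ^ t` is the `t`-step transition probability (the `t`-fold
composition of the kernel `Q` with itself). -/
def preimage (Q : Kernel X X) (t : ℕ) (B : Set X) : Set X :=
  {x | 0 < (Q ^ t) x B}

variable [TopologicalSpace X]

/-- Recurrent points: the chain started at `x` is, at some time `t ≥ 1`, in a given open
neighbourhood of `x` with positive probability. -/
def Rec (Q : Kernel X X) : Set X :=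
  {x | ∀ O : Set X, IsOpen O → x ∈ O → ∃ t : ℕ, 1 ≤ t ∧ 0 < (Q ^ t) x O}

/-- Weakly recurrent points. -/
def RecW (Q : Kernel X X) : Set X :=
  {x | ∀ O : Set X, IsOpen O → x ∈ O → ∃ y ∈ O, ∃ t : ℕ, 1 ≤ t ∧ 0 < (Q ^ t) y O}

/-- Uniformly recurrent points. -/
def RecU (Q : Kernel X X) : Set X :=
  {x | ∀ O : Set X, IsOpen O → x ∈ O →
    0 < Filter.liminf (fun n : ℕ => (Q ^ n) x O) Filter.atTop}

/-- Weakly uniformly recurrent points. -/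
def RecWU (Q : Kernel X X) : Set X :=
  {x | ∀ O : Set X, IsOpen O → x ∈ O →
    ∃ y ∈ O, 0 < Filter.liminf (fun n : ℕ => (Q ^ n) y O) Filter.atTop}

end MarkovRecurrence

namespace MarkovRecurrence

open scoped ENNReal

section Kernel

variable {X : Type*} [MeasurableSpace X] {Q : Kernel X X}

/-! Everything rests on sets `A` to which the chain never returns from `A`. Under the hypothesis of
(a) such a set is null, as its series vanishes. From any start, the expected number of visits to it
is at most 1 (`sum_pow_apply_le_one`). Integrating this against an invariant `μ` gives `N * μ A ≤ 1`
for all `N`, so `μ A = 0`. The non-recurrent points form a countable union of such sets, whence (a)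
and (c). For (b), finitely many such sets cannot cover `X`, since the total time spent in them is
bounded. -/

instance isMarkovKernel_pow [IsMarkovKernel Q] (n : ℕ) : IsMarkovKernel (Q ^ n) := by
  induction n with
  | zero => rw [pow_zero]; exact inferInstanceAs (IsMarkovKernel Kernel.id)
  | succ n ih => rw [pow_succ]; exact inferInstanceAs (IsMarkovKernel ((Q ^ n) ∘ₖ Q))

/-- If the chain never returns to `A` after starting in `A`, then the expected number of visits
to `A`, from any starting point, is at most one. -/
theorem sum_pow_apply_le_one [IsMarkovKernel Q] {A : Set X} (hA : MeasurableSet A)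
    (h : ∀ x ∈ A, ∀ t : ℕ, 1 ≤ t → (Q ^ t) x A = 0) (N : ℕ) (x : X) :
    ∑ n ∈ Finset.range N, (Q ^ n) x A ≤ 1 := by
  induction N generalizing x with
  | zero => simp
  | succ N ih =>
    -- Time 0 is split off. From inside `A` only that term survives; from outside it vanishes, and
    -- conditioning on the first step reduces to `N` visits.
    rw [Finset.sum_range_succ']
    by_cases hx : x ∈ A
    · rw [Finset.sum_eq_zero fun n _ => h x hx (n + 1) n.succ_pos, zero_add]
      exact prob_le_one
    · have h0 : (Q ^ 0) x A = 0 := by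
        rw [pow_zero]
        change Kernel.id x A = 0
        simp [Kernel.id_apply, Measure.dirac_apply' x hA, hx]
      calc ∑ n ∈ Finset.range N, (Q ^ (n + 1)) x A + (Q ^ 0) x A
          = ∫⁻ y, ∑ n ∈ Finset.range N, (Q ^ n) y A ∂(Q x) := by
            rw [h0, add_zero, lintegral_finsetSum _ fun n _ => Kernel.measurable_coe _ hA]
            refine Finset.sum_congr rfl fun n _ => ?_
            rw [pow_succ]
            exact Kernel.comp_apply' _ _ _ hA
        _ ≤ ∫⁻ _, 1 ∂(Q x) := lintegral_mono fun y => ih y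
        _ = 1 := by simp

theorem lintegral_pow_apply_of_invariant {μ : Measure X} (hμ : Kernel.Invariant Q μ)
    {A : Set X} (hA : MeasurableSet A) (n : ℕ) : ∫⁻ x, (Q ^ n) x A ∂μ = μ A := by
  have hn : Kernel.Invariant (Q ^ n) μ := by
    induction n with
    | zero => rw [pow_zero]; exact Measure.bind_dirac
    | succ n ih => rw [pow_succ]; exact ih.comp hμ
  rw [← Measure.bind_apply hA (Kernel.aemeasurable _), hn.def]

/-- An invariant probability measure does not charge a set to which the chain never returns. -/
theorem measure_eq_zero_of_invariant [IsMarkovKernel Q] {μ : Measure X} [IsProbabilityMeasure μ]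
    (hμ : Kernel.Invariant Q μ) {A : Set X} (hA : MeasurableSet A)
    (h : ∀ x ∈ A, ∀ t : ℕ, 1 ≤ t → (Q ^ t) x A = 0) : μ A = 0 := by
  by_contra hne
  obtain ⟨N, hN⟩ := ENNReal.exists_nat_mul_gt hne ENNReal.one_ne_top
  refine hN.not_ge ?_
  calc (N : ℝ≥0∞) * μ A = ∫⁻ x, ∑ n ∈ Finset.range N, (Q ^ n) x A ∂μ := by
        rw [lintegral_finsetSum _ fun n _ => Kernel.measurable_coe _ hA]
        simp [lintegral_pow_apply_of_invariant hμ hA]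
    _ ≤ ∫⁻ _, 1 ∂μ := lintegral_mono fun x => sum_pow_apply_le_one hA h N x
    _ = 1 := by simp

/-- The points of `O` from which the chain never returns to `O`. -/
def neverReturning (Q : Kernel X X) (O : Set X) : Set X :=
  {x | x ∈ O ∧ ∀ t : ℕ, 1 ≤ t → (Q ^ t) x O = 0}

theorem measurableSet_neverReturning {O : Set X} (hO : MeasurableSet O) :
    MeasurableSet (neverReturning Q O) := by
  have : neverReturning Q O = O ∩ ⋂ t : ℕ, ⋂ _ : 1 ≤ t, {x | (Q ^ t) x O = 0} := by
    ext x; simp [neverReturning]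
  rw [this]
  exact hO.inter <| .iInter fun t => .iInter fun _ =>
    Kernel.measurable_coe (Q ^ t) hO (measurableSet_singleton 0)

theorem pow_apply_neverReturning_eq_zero {O : Set X} {x : X} (hx : x ∈ neverReturning Q O)
    {t : ℕ} (ht : 1 ≤ t) : (Q ^ t) x (neverReturning Q O) = 0 :=
  measure_mono_null (fun _ hy => hy.1) (hx.2 t ht)

theorem measure_neverReturning_eq_zero {m : Measure X}
    (h : ∀ A : Set X, MeasurableSet A → 0 < m A → ∑' n : ℕ+, m (preimage Q n A ∩ A) = ⊤)
    {O : Set X} (hO : MeasurableSet O) : m (neverReturning Q O) = 0 := by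
  by_contra hne
  have hempty : ∀ n : ℕ+, preimage Q n (neverReturning Q O) ∩ neverReturning Q O = ∅ :=
    fun n => Set.eq_empty_of_forall_notMem fun x hx =>
      hx.1.ne' (pow_apply_neverReturning_eq_zero hx.2 n.2)
  simpa [hempty] using h _ (measurableSet_neverReturning hO) (pos_iff_ne_zero.2 hne)

end Kernel

section Topology

open TopologicalSpace

variable {X : Type*} [TopologicalSpace X] [MeasurableSpace X] {Q : Kernel X X}

theorem recU_subset_rec : RecU Q ⊆ Rec Q := fun _ hx O hO hxO =>
  ((Filter.eventually_lt_of_lt_liminf (hx O hO hxO)).and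
    (Filter.eventually_ge_atTop 1)).exists.imp fun _ h => h.symm

theorem recU_subset_recWU : RecU Q ⊆ RecWU Q := fun x hx O hO hxO => ⟨x, hxO, hx O hO hxO⟩

theorem recWU_subset_recW : RecWU Q ⊆ RecW Q := fun _ hx O hO hxO =>
  let ⟨y, hy, h⟩ := hx O hO hxO
  ⟨y, hy, ((Filter.eventually_lt_of_lt_liminf h).and
    (Filter.eventually_ge_atTop 1)).exists.imp fun _ h => h.symm⟩

theorem closure_rec_subset_recW : closure (Rec Q) ⊆ RecW Q := fun _ hx O hO hxO =>
  let ⟨y, hyO, hy⟩ := mem_closure_iff.1 hx O hO hxO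
  ⟨y, hyO, hy O hO hyO⟩

/-- Failure to return to a neighbourhood of `x` passes to every smaller one, so basic open sets
suffice. -/
theorem compl_rec_eq_biUnion_countableBasis [SecondCountableTopology X] :
    (Rec Q)ᶜ = ⋃ O ∈ countableBasis X, neverReturning Q O := by
  ext x
  simp only [Rec, neverReturning, Set.mem_compl_iff, Set.mem_ofPred_eq, Set.mem_iUnion,
    exists_prop, not_forall, not_exists, not_and, not_lt, nonpos_iff_eq_zero]
  constructor
  · rintro ⟨U, hU, hxU, h⟩
    obtain ⟨O, hO, hxO, hOU⟩ := (isBasis_countableBasis X).exists_subset_of_mem_open hxU hU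
    exact ⟨O, hO, hxO, fun t ht => measure_mono_null hOU (h t ht)⟩
  · rintro ⟨O, hO, hxO, h⟩
    exact ⟨O, isOpen_of_mem_countableBasis hO, hxO, h⟩

theorem ae_mem_rec [SecondCountableTopology X] [OpensMeasurableSpace X] {μ : Measure X}
    (h : ∀ O : Set X, IsOpen O → μ (neverReturning Q O) = 0) : ∀ᵐ x ∂μ, x ∈ Rec Q := by
  change μ (Rec Q)ᶜ = 0
  rw [compl_rec_eq_biUnion_countableBasis, measure_biUnion_null_iff (countable_countableBasis X)]
  exact fun O hO => h O (isOpen_of_mem_countableBasis hO)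

theorem support_subset_closure_of_ae_mem {m : Measure X} {s : Set X} (h : ∀ᵐ x ∂m, x ∈ s) :
    m.support ⊆ closure s :=
  Measure.support_subset_of_isClosed isClosed_closure (h.mono fun _ hx => subset_closure hx)

theorem recW_nonempty [CompactSpace X] [Nonempty X] [OpensMeasurableSpace X] [IsMarkovKernel Q] :
    (RecW Q).Nonempty := by
  by_contra hempty
  have hcov : ∀ x : X, ∃ O : Set X, IsOpen O ∧ x ∈ O ∧
      ∀ y ∈ O, ∀ t : ℕ, 1 ≤ t → (Q ^ t) y O = 0 := fun x => by
    by_contra! hx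
    exact hempty ⟨x, fun O hO hxO =>
      let ⟨y, hy, t, ht, hne⟩ := hx O hO hxO
      ⟨y, hy, t, ht, pos_iff_ne_zero.2 hne⟩⟩
  choose O hO hmem hnull using hcov
  obtain ⟨s, hs⟩ := isCompact_univ.elim_finite_subcover O hO
    fun x _ => Set.mem_iUnion.2 ⟨x, hmem x⟩
  obtain ⟨x⟩ := ‹Nonempty X›
  -- Each of `s.card + 1` times carries mass 1, but each of the `s.card` covering sets absorbs at
  -- most 1 in total.
  have hle : ((s.card + 1 : ℕ) : ℝ≥0∞) ≤ s.card :=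
    calc ((s.card + 1 : ℕ) : ℝ≥0∞)
        = ∑ n ∈ Finset.range (s.card + 1), (Q ^ n) x Set.univ := by simp
      _ ≤ ∑ n ∈ Finset.range (s.card + 1), ∑ i ∈ s, (Q ^ n) x (O i) :=
          Finset.sum_le_sum fun n _ => (measure_mono hs).trans (measure_biUnion_finset_le s O)
      _ = ∑ i ∈ s, ∑ n ∈ Finset.range (s.card + 1), (Q ^ n) x (O i) := Finset.sum_comm
      _ ≤ ∑ _i ∈ s, 1 := Finset.sum_le_sum fun i _ =>
          sum_pow_apply_le_one (hO i).measurableSet (hnull i) _ x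
      _ = s.card := by simp
  exact absurd (Nat.cast_le.1 hle) (by omega)

end Topology

end MarkovRecurrence

theorem theorem2 {X : Type*} [MetricSpace X] [CompactSpace X] [Nonempty X]
    [MeasurableSpace X] [BorelSpace X]
    (m : Measure X) [IsFiniteMeasure m] (Q : Kernel X X) [IsMarkovKernel Q] :
    -- (0)
    (MarkovRecurrence.RecU Q ⊆ MarkovRecurrence.Rec Q ∧
      MarkovRecurrence.RecU Q ⊆ MarkovRecurrence.RecWU Q ∧
      MarkovRecurrence.RecWU Q ⊆ MarkovRecurrence.RecW Q ∧
      closure (MarkovRecurrence.Rec Q) ⊆ MarkovRecurrence.RecW Q) ∧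
    -- (a)
    ((∀ A : Set X, MeasurableSet A → 0 < m A →
        ∑' n : ℕ+, m (MarkovRecurrence.preimage Q n A ∩ A) = ⊤) →
      m (MarkovRecurrence.Rec Q) = m Set.univ ∧ m.support ⊆ MarkovRecurrence.RecW Q) ∧
    -- (b)
    (MarkovRecurrence.RecW Q).Nonempty ∧
    -- (c)
    (∀ μ : Measure X, IsProbabilityMeasure μ → Kernel.Invariant Q μ →
      μ (MarkovRecurrence.Rec Q) = 1) := by
  have ha : ∀ h : ∀ A : Set X, MeasurableSet A → 0 < m A →
      ∑' n : ℕ+, m (MarkovRecurrence.preimage Q n A ∩ A) = ⊤,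
      ∀ᵐ x ∂m, x ∈ MarkovRecurrence.Rec Q := fun h =>
    MarkovRecurrence.ae_mem_rec fun O hO =>
      MarkovRecurrence.measure_neverReturning_eq_zero h hO.measurableSet
  refine ⟨⟨MarkovRecurrence.recU_subset_rec, MarkovRecurrence.recU_subset_recWU,
    MarkovRecurrence.recWU_subset_recW, MarkovRecurrence.closure_rec_subset_recW⟩,
    fun h => ⟨measure_congr (Filter.eventuallyEq_univ.2 (ha h)),
      (MarkovRecurrence.support_subset_closure_of_ae_mem (ha h)).trans
        MarkovRecurrence.closure_rec_subset_recW⟩,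
    MarkovRecurrence.recW_nonempty, fun μ _ hμ => ?_⟩
  have hμ_ae : ∀ᵐ x ∂μ, x ∈ MarkovRecurrence.Rec Q :=
    MarkovRecurrence.ae_mem_rec fun O hO =>
      MarkovRecurrence.measure_eq_zero_of_invariant hμ
        (MarkovRecurrence.measurableSet_neverReturning hO.measurableSet)
        fun x hx t ht => MarkovRecurrence.pow_apply_neverReturning_eq_zero hx ht
  exact (measure_congr (Filter.eventuallyEq_univ.2 hμ_ae)).trans measure_univ
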